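/- Let $(\xi_n)_{n\ge 1}$ be independent identically distributed real random variables on a probability space, with $|\xi_n|\le 1$ and $\mathbb P\{\xi_1\in(1-\varepsilon,1]\}>0$ for every $\varepsilon>0$. Let $f:[0,\infty)\to[0,\infty)$ be continuous with $f(0)=0$, and let $K>0$ be a locally unstable (i.e. not Lyapunov stable) equilibrium, $f(K)=K$, such that $f(x)>x$ for $x\in(0,K)$ and $0<f(x)<x$ for $x>K$. Assume that for some $\theta\in(0,K)$, $\tilde L^-,\tilde L^+\in\mathbb R$ and $a_1,a_2>0$, $$f(x)-K\le \tilde L^-(K-x)\ \ (x\in[K-\theta,K]),\qquad K-f(x)\le \tilde L^+(x-K)\ \ (x\in[K,K+\theta]),$$ $$f(x)>a_1(K-x)+K\ \ (x\in(K-\theta,K)),\qquad f(x)<a_2(K-x)+K\ \ (x\in(K,K+\theta)).$$ Put $f_m=\max_{[0,K]}f$, $f_m^2=\inf_{(K,f_m)}f$, $G(\beta,x)=(1-\beta)f(x)+\beta x$, $G^2(\beta,x)=G(\beta,G(\beta,x))$, $\mathcal L^{\pm}(\beta)=(1-\beta)\tilde L^{\pm}-\beta$, and $$\underline\beta_*=\inf\{\beta\in(0,1):\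 G^2(\beta,x)>x\ \text{for } x\in(f_m^2,K)\ \text{and}\ G^2(\beta,x)<x\ \text{for } x\in(K,f_m)\}.$$ Let $\alpha,\ell$ be real numbers such that $$\mathbb E\ln\left|\mathcal L^-(\alpha+\ell\xi_1)\,\mathcal L^+(\alpha+\ell\xi_1)\right|<0,\qquad \alpha+\ell\le\min\left\{\frac{a_1}{a_1+1},\frac{a_2}{a_2+1}\right\},$$ $$0<\alpha<\underline\beta_*,\qquad \underline\beta_*-\alpha<\ell<\min\{\alpha,1-\alpha\}.$$ Then for every (deterministic) $x_0>0$ the solution of $$x_{n+1}=(1-\alpha-\ell\xi_{n+1})f(x_n)+(\alpha+\ell\xi_{n+1})x_n,\qquad n\ge 0,$$ satisfies $\lim_{n\to\infty}x_n=K$ almost surely. -/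

import Mathlib

open MeasureTheory ProbabilityTheory Filter Topology Set

noncomputable section

namespace PBC

/-- The sequence `ξ 0, ξ 1, …` lists the noises `ξ₁, ξ₂, …`: independent, identically distributed
random variables with values in `[-1, 1]` almost surely, whose law charges `(1 - ε, 1]` for every
`ε > 0`. -/
structure NoiseAssumption {Ω : Type*} [MeasurableSpace Ω] (μ : Measure Ω)
    (ξ : ℕ → Ω → ℝ) : Prop where
  measurable : ∀ n, Measurable (ξ n)
  indep : iIndepFun ξ μ
  identDistrib : ∀ n, IdentDistrib (ξ n) (ξ 0) μ μ
  bounded : ∀ n, ∀ᵐ ω ∂μ, |ξ n ω| ≤ 1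
  charges_one : ∀ ε : ℝ, 0 < ε → 0 < μ {ω | ξ 0 ω ∈ Ioc (1 - ε) 1}

/-- Lyapunov stability of `K` for the map `f` on `[0, ∞)`. -/
def IsLocallyStable (f : ℝ → ℝ) (K : ℝ) : Prop :=
  ∀ ε : ℝ, 0 < ε → ∃ δ : ℝ, 0 < δ ∧
    ∀ x : ℝ, 0 ≤ x → |x - K| < δ → ∀ n : ℕ, |f^[n] x - K| < ε

/-- The standing assumption on the map `f : [0, ∞) → [0, ∞)` and its positive equilibrium `K`.
Values of `f` at negative arguments play no role. -/
structure MapAssumption (f : ℝ → ℝ) (K : ℝ) : Prop where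
  K_pos : 0 < K
  mapsTo : MapsTo f (Ici 0) (Ici 0)
  continuousOn : ContinuousOn f (Ici 0)
  map_zero : f 0 = 0
  map_K : f K = K
  unstable : ¬ IsLocallyStable f K
  gt_self : ∀ x ∈ Ioo 0 K, x < f x
  pos_lt_self : ∀ x ∈ Ioi K, 0 < f x ∧ f x < x

/-- Local one-sided Lipschitz bounds at `K`. -/
def LocalLipschitz (f : ℝ → ℝ) (K θ Lm Lp : ℝ) : Prop :=
  (∀ x ∈ Icc (K - θ) K, f x - K ≤ Lm * (K - x)) ∧
    ∀ x ∈ Icc K (K + θ), K - f x ≤ Lp * (x - K)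

/-- `f` switches the side of `K`, with slopes at least `a₁` on the left and `a₂` on the right. -/
def SideSwitching (f : ℝ → ℝ) (K θ a₁ a₂ : ℝ) : Prop :=
  (∀ x ∈ Ioo (K - θ) K, a₁ * (K - x) + K < f x) ∧
    ∀ x ∈ Ioo K (K + θ), f x < a₂ * (K - x) + K

/-- `f_m`, the maximum of `f` on `[0, K]`. -/
def fMax (f : ℝ → ℝ) (K : ℝ) : ℝ := sSup (f '' Icc 0 K)

/-- `f_m²`, the infimum of `f` on `(K, f_m)`. -/
def fMin (f : ℝ → ℝ) (K : ℝ) : ℝ := sInf (f '' Ioo K (fMax f K))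

/-- The controlled map `G(β, x) = (1 - β) f(x) + β x`. -/
def G (f : ℝ → ℝ) (β x : ℝ) : ℝ := (1 - β) * f x + β * x

/-- The controls `β` for which the second iterate of `G(β, ·)` moves every point of
`(f_m², K)` to the right and every point of `(K, f_m)` to the left. -/
def stabilizing (f : ℝ → ℝ) (K : ℝ) : Set ℝ :=
  {β | β ∈ Ioo (0 : ℝ) 1 ∧
    (∀ x ∈ Ioo (fMin f K) K, x < G f β (G f β x)) ∧
    ∀ x ∈ Ioo K (fMax f K), G f β (G f β x) < x}

/-- The sharp deterministic control level. -/
def betaStar (f : ℝ → ℝ) (K : ℝ) : ℝ := sInf (stabilizing f K)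

/-- `𝓛(β) = (1 - β) L - β`. -/
def scrL (L β : ℝ) : ℝ := (1 - β) * L - β

/-- `x` solves `x_{n+1} = (1 - α - ℓ ξ_{n+1}) f(x_n) + (α + ℓ ξ_{n+1}) x_n` with initial value
`x₀`; recall that `ξ n` stands for `ξ_{n+1}`. -/
def IsSolution {Ω : Type*} (f : ℝ → ℝ) (α ℓ : ℝ) (ξ : ℕ → Ω → ℝ) (x₀ : ℝ)
    (x : ℕ → Ω → ℝ) : Prop :=
  (∀ ω, x 0 ω = x₀) ∧
    ∀ n ω, x (n + 1) ω = (1 - α - ℓ * ξ n ω) * f (x n ω) + (α + ℓ * ξ n ω) * x n ω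

end PBC

end

/-!
Under the constant control `B` the second iterate moves every point of `[f_m², f_m]` towards `K`, so
the intersection of the nested images of this compact interval is `{K}`: some number `N` of steps
brings the whole interval close to `K`. By uniform continuity the same `N` suffices for every
sequence of controls whose first `N` terms are close to `B`. A positive trajectory cannot stay
outside the interval, since it would be monotone there and converge to a fixed point other than `K`;
once inside, it never leaves.

Near `K` a trajectory alternates between the two sides, and its distance to `K` is multiplied in
turn by at most `𝓛⁻` and `𝓛⁺`. By the strong law of large numbers the products of these rates tend
to `0` almost surely, hence with positive probability they are also bounded by some constant `C`.
A trajectory that starts within `θ / C` of `K` under such controls stays within `θ` of `K` and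
converges.

With positive probability, `N` controls close to `B` are followed by controls with vanishing
products bounded by `C`. The controls being stationary, the zero-one law of Kolmogorov makes this
happen at infinitely many times, in particular when the trajectory is already in `[f_m², f_m]`.
-/

namespace PBC

section IntervalMaps

variable {X : Type*} [TopologicalSpace X]

theorem exists_iterate_mapsTo_of_subset_image [T2Space X] {g : X → X} {s U : Set X}
    (hs : IsCompact s) (hg : ContinuousOn g s) (hgs : MapsTo g s s) (hU : IsOpen U)
    (hinv : ∀ Λ ⊆ s, IsCompact Λ → Λ ⊆ g '' Λ → Λ ⊆ U) : ∃ n, MapsTo g^[n] s U := by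
  set V : ℕ → Set X := fun n => g^[n] '' s
  have hVc : ∀ n, IsCompact (V n) := fun n => hs.image_of_continuousOn (hg.iterate hgs n)
  have hVs : ∀ n, V n ⊆ s := fun n => (hgs.iterate n).image_subset
  have hVg : ∀ n, V (n + 1) = g '' V n := fun n => by
    simp only [V, Function.iterate_succ', image_comp]
  have hVanti : Antitone V := antitone_nat_of_succ_le fun n => by
    simp only [V, Function.iterate_succ, image_comp]
    exact image_mono hgs.image_subset
  have hfixed : ⋂ n, V n ⊆ g '' ⋂ n, V n := by
    intro y hy
    have hclosed : ∀ n, IsClosed (V n ∩ g ⁻¹' {y}) := fun n =>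
      (hg.mono (hVs n)).preimage_isClosed_of_isClosed (hVc n).isClosed isClosed_singleton
    obtain ⟨x, hx⟩ := IsCompact.nonempty_iInter_of_sequence_nonempty_isCompact_isClosed
      (fun n => V n ∩ g ⁻¹' {y})
      (fun n => inter_subset_inter_left _ (hVanti n.le_succ))
      (fun n => by
        have hyn := mem_iInter.1 hy (n + 1)
        rw [hVg n] at hyn
        exact hyn)
      ((hVc 0).of_isClosed_subset (hclosed 0) inter_subset_left) hclosed
    exact ⟨x, mem_iInter.2 fun n => (mem_iInter.1 hx n).1, (mem_iInter.1 hx 0).2⟩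
  have hsub : ⋂ n, V n ⊆ U :=
    hinv _ ((iInter_subset V 0).trans (hVs 0))
      ((hVc 0).of_isClosed_subset (isClosed_iInter fun n => (hVc n).isClosed)
        (iInter_subset V 0)) hfixed
  obtain ⟨n, hn⟩ := exists_subset_nhds_of_isCompact hVanti.directed_ge hVc
    fun x hx => hU.mem_nhds (hsub hx)
  exact ⟨n, mapsTo_iff_image_subset.2 hn⟩

variable [ConditionallyCompleteLinearOrder X] [OrderTopology X] [DenselyOrdered X]

-- If `h x` lies beyond `K`, then it has a `g`-preimage `z ∈ [x, K)`, and `h (h x) ≥ g (g z) > z`.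
theorem lt_apply_apply_of_le {g h : X → X} {x K : X} (hg : ContinuousOn g (Icc x K))
    (hgK : g K = K) (hxK : x < K) (hcycle : ∀ z ∈ Ico x K, z < g (g z)) (hx : x < h x)
    (hhg : h x ≤ g x) (hle : h x ≤ K → h x ≤ h (h x)) (hge : K < h x → g (h x) ≤ h (h x)) :
    x < h (h x) := by
  rcases le_or_gt (h x) K with hK | hK
  · exact hx.trans_le (hle hK)
  · obtain ⟨z, hz, hzx⟩ := intermediate_value_Ico' hxK.le hg ⟨by rwa [hgK], hhg⟩
    calc x ≤ z := hz.1
      _ < g (g z) := hcycle z hz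
      _ = g (h x) := by rw [hzx]
      _ ≤ h (h x) := hge hK

-- Otherwise the least point `A < K` of `Λ` is `g v` for some `v > K` in `Λ`, and `v = g z` for some
-- `z ∈ [A, K)`, so that `g (g z) = A ≤ z`.
theorem subset_singleton_of_subset_image {g : X → X} {p K : X} {Λ : Set X}
    (hg : ContinuousOn g (Ioc p K)) (hgK : g K = K) (hleft : ∀ z ∈ Ioo p K, z < g z)
    (hcycle : ∀ z ∈ Ioo p K, z < g (g z)) (hright : ∀ z ∈ Λ, K < z → g z < z)
    (hΛ : IsCompact Λ) (hp : Λ ⊆ Ioi p) (hinv : Λ ⊆ g '' Λ) : Λ ⊆ {K} := by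
  rcases Λ.eq_empty_or_nonempty with rfl | hne
  · exact empty_subset _
  obtain ⟨A, hA⟩ := hΛ.exists_isLeast hne
  obtain ⟨B, hB⟩ := hΛ.exists_isGreatest hne
  obtain ⟨v, hv, hgv⟩ := hinv hA.1
  obtain ⟨u, hu, hgu⟩ := hinv hB.1
  have huK : u ≤ K := not_lt.1 fun h => ((hright u hu h).trans_le (hB.2 hu)).ne hgu
  have hKA : K ≤ A := by
    by_contra! hAK
    have hKv : K < v := by
      by_contra! hvK
      rcases hvK.eq_or_lt with rfl | hvK
      · exact hAK.ne (hgv.symm.trans hgK)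
      · exact ((hleft v ⟨hp hv, hvK⟩).trans_le (hgv.le.trans (hA.2 hv))).false
    obtain ⟨z, hz, hgz⟩ := intermediate_value_Ico' huK
      (hg.mono (Icc_subset_Ioc_iff huK |>.2 ⟨hp hu, le_rfl⟩))
      (show v ∈ Ioc (g K) (g u) from ⟨hgK.trans_lt hKv, (hB.2 hv).trans_eq hgu.symm⟩)
    refine (hcycle z ⟨(hp hu).trans_le hz.1, hz.2⟩).not_ge ?_
    calc g (g z) = A := by rw [hgz, hgv]
      _ ≤ u := hA.2 hu
      _ ≤ z := hz.1
  have hBK : B = K := by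
    rw [← hgu, le_antisymm huK (hKA.trans (hA.2 hu)), hgK]
  exact fun x hx => le_antisymm ((hB.2 hx).trans_eq hBK) (hKA.trans (hA.2 hx))

theorem exists_iterate_mapsTo_of_lt_apply_apply {g : X → X} {p q K : X} {U : Set X}
    (hg : ContinuousOn g (Icc p q)) (hmaps : MapsTo g (Icc p q) (Ioo p q)) (hKq : K ≤ q)
    (hgK : g K = K) (hleft : ∀ z ∈ Ioo p K, z < g z) (hright : ∀ z ∈ Ioc K q, g z < z)
    (hcycle : ∀ z ∈ Ioo p K, z < g (g z)) (hU : IsOpen U) (hKU : K ∈ U) :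
    ∃ n, MapsTo g^[n] (Icc p q) U := by
  refine exists_iterate_mapsTo_of_subset_image isCompact_Icc hg
    (hmaps.mono_right Ioo_subset_Icc_self) hU fun Λ hΛs hΛ hinv => ?_
  have hp : Λ ⊆ Ioi p := fun y hy => by
    obtain ⟨x, hx, rfl⟩ := hinv hy
    exact (hmaps (hΛs hx)).1
  exact (subset_singleton_of_subset_image
    (hg.mono (Ioc_subset_Icc_self.trans (Icc_subset_Icc_right hKq))) hgK hleft hcycle
    (fun z hz hKz => hright z ⟨hKz, (hΛs hz).2⟩) hΛ hp hinv).trans (singleton_subset_iff.2 hKU)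

end IntervalMaps

section ControlledMap

variable {f : ℝ → ℝ} {K β β' x : ℝ}

theorem continuousOn_G {s : Set ℝ} (hf : ContinuousOn f s) (β : ℝ) : ContinuousOn (G f β) s := by
  unfold G
  fun_prop

theorem G_sub_self (f : ℝ → ℝ) (β x : ℝ) : G f β x - x = (1 - β) * (f x - x) := by
  unfold G; ring

theorem G_sub_G (f : ℝ → ℝ) (β β' x : ℝ) : G f β' x - G f β x = (β - β') * (f x - x) := by
  unfold G; ring

theorem G_le_G_of_le_map (h : β ≤ β') (hx : x ≤ f x) : G f β' x ≤ G f β x :=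
  sub_nonpos.1 <| (G_sub_G f β β' x).trans_le <|
    mul_nonpos_of_nonpos_of_nonneg (sub_nonpos.2 h) (sub_nonneg.2 hx)

theorem G_le_G_of_map_le (h : β ≤ β') (hx : f x ≤ x) : G f β x ≤ G f β' x :=
  sub_nonneg.1 <| (mul_nonneg_of_nonpos_of_nonpos (sub_nonpos.2 h) (sub_nonpos.2 hx)).trans_eq
    (G_sub_G f β β' x).symm

theorem G_eq_of_map_eq (hK : f K = K) (β : ℝ) : G f β K = K := by
  unfold G; rw [hK]; ring

/-- A map `f`, continuous on `[0, ∞)`, that moves every positive point in the direction of its fixed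
point `K > 0`, possibly overshooting it. Positivity of `f` is imposed only beyond `K`, because on
`(0, K)` it follows from `x < f x`. -/
structure PositiveEquilibrium (f : ℝ → ℝ) (K : ℝ) : Prop where
  K_pos : 0 < K
  continuousOn : ContinuousOn f (Ici 0)
  map_K : f K = K
  lt_map : ∀ x ∈ Ioo 0 K, x < f x
  map_pos_lt : ∀ x ∈ Ioi K, 0 < f x ∧ f x < x

theorem MapAssumption.positiveEquilibrium (hf : MapAssumption f K) : PositiveEquilibrium f K where
  K_pos := hf.K_pos
  continuousOn := hf.continuousOn
  map_K := hf.map_K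
  lt_map := hf.gt_self
  map_pos_lt := hf.pos_lt_self

namespace PositiveEquilibrium

theorem map_pos (hf : PositiveEquilibrium f K) (hx : 0 < x) : 0 < f x := by
  rcases lt_trichotomy x K with h | rfl | h
  · exact hx.trans (hf.lt_map x ⟨hx, h⟩)
  · exact hx.trans_eq hf.map_K.symm
  · exact (hf.map_pos_lt x h).1

theorem le_map (hf : PositiveEquilibrium f K) (hx : x ∈ Ioc 0 K) : x ≤ f x := by
  rcases hx.2.eq_or_lt with rfl | h
  · exact hf.map_K.ge
  · exact (hf.lt_map x ⟨hx.1, h⟩).le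

theorem map_le (hf : PositiveEquilibrium f K) (hx : K ≤ x) : f x ≤ x := by
  rcases hx.eq_or_lt with rfl | h
  · exact hf.map_K.le
  · exact (hf.map_pos_lt x h).2.le

theorem eq_K_of_map_eq (hf : PositiveEquilibrium f K) (hx : 0 < x) (h : f x = x) : x = K := by
  rcases lt_trichotomy x K with hlt | heq | hgt
  · exact absurd h (hf.lt_map x ⟨hx, hlt⟩).ne'
  · exact heq
  · exact absurd h (hf.map_pos_lt x hgt).2.ne

theorem G_K (hf : PositiveEquilibrium f K) (β : ℝ) : G f β K = K :=
  G_eq_of_map_eq hf.map_K β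

theorem lt_G (hf : PositiveEquilibrium f K) (hβ : β < 1) (hx : x ∈ Ioo 0 K) : x < G f β x :=
  sub_pos.1 <| (mul_pos (sub_pos.2 hβ) (sub_pos.2 (hf.lt_map x hx))).trans_eq
    (G_sub_self f β x).symm

theorem G_lt (hf : PositiveEquilibrium f K) (hβ : β < 1) (hx : K < x) : G f β x < x :=
  sub_neg.1 <| (G_sub_self f β x).trans_lt <|
    mul_neg_of_pos_of_neg (sub_pos.2 hβ) (sub_neg.2 (hf.map_pos_lt x hx).2)

theorem le_G (hf : PositiveEquilibrium f K) (hβ : β < 1) (hx : x ∈ Ioc 0 K) : x ≤ G f β x := by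
  rcases hx.2.eq_or_lt with rfl | h
  · exact (hf.G_K β).ge
  · exact (hf.lt_G hβ ⟨hx.1, h⟩).le

theorem G_le (hf : PositiveEquilibrium f K) (hβ : β < 1) (hx : K ≤ x) : G f β x ≤ x := by
  rcases hx.eq_or_lt with rfl | h
  · exact (hf.G_K β).le
  · exact (hf.G_lt hβ h).le

theorem G_pos (hf : PositiveEquilibrium f K) (hβ : β ∈ Ico 0 1) (hx : 0 < x) : 0 < G f β x :=
  add_pos_of_pos_of_nonneg (mul_pos (sub_pos.2 hβ.2) (hf.map_pos hx)) (mul_nonneg hβ.1 hx.le)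

theorem le_fMax (hf : PositiveEquilibrium f K) (hx : x ∈ Icc 0 K) : f x ≤ fMax f K :=
  le_csSup (isCompact_Icc.bddAbove_image (hf.continuousOn.mono Icc_subset_Ici_self))
    (mem_image_of_mem f hx)

theorem fMin_le_of_mem_Ioo (hf : PositiveEquilibrium f K) (hx : x ∈ Ioo K (fMax f K)) :
    fMin f K ≤ f x :=
  csInf_le ⟨0, forall_mem_image.2 fun y hy => (hf.map_pos_lt y hy.1).1.le⟩ (mem_image_of_mem f hx)

theorem fMin_nonneg (hf : PositiveEquilibrium f K) : 0 ≤ fMin f K :=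
  Real.sInf_nonneg <| forall_mem_image.2 fun x hx => (hf.map_pos_lt x hx.1).1.le

theorem continuousOn_Icc (hf : PositiveEquilibrium f K) (hx : 0 ≤ x) (y : ℝ) :
    ContinuousOn f (Icc x y) :=
  hf.continuousOn.mono (Icc_subset_Ici_self.trans (Ici_subset_Ici.2 hx))

theorem fMin_le (hf : PositiveEquilibrium f K) (hK : K < fMax f K) (hx : x ∈ Icc K (fMax f K)) :
    fMin f K ≤ f x := by
  have hsub : MapsTo f (Ioo K (fMax f K)) (Ici (fMin f K)) := fun y hy => hf.fMin_le_of_mem_Ioo hy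
  rw [← closure_Ioo hK.ne] at hx
  refine hsub.closure_of_continuousOn ?_ hx |> isClosed_Ici.closure_subset
  rw [closure_Ioo hK.ne]
  exact hf.continuousOn_Icc hf.K_pos.le _

theorem fMin_pos (hf : PositiveEquilibrium f K) (hK : K < fMax f K) : 0 < fMin f K := by
  obtain ⟨z, hz, hmin⟩ := isCompact_Icc.exists_isMinOn (nonempty_Icc.2 hK.le)
    (hf.continuousOn_Icc hf.K_pos.le (fMax f K))
  exact (hf.map_pos (hf.K_pos.trans_le hz.1)).trans_le <|
    le_csInf ((nonempty_Ioo.2 hK).image f) <|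
      forall_mem_image.2 fun y hy => hmin (Ioo_subset_Icc_self hy)

theorem K_lt_fMax (hf : PositiveEquilibrium f K) {θ a₁ a₂ : ℝ} (hθ : 0 < θ) (ha₁ : 0 < a₁)
    (hside : SideSwitching f K θ a₁ a₂) : K < fMax f K := by
  obtain ⟨x, hx, hxK⟩ := exists_between (max_lt hf.K_pos (sub_lt_self K hθ))
  calc K < a₁ * (K - x) + K := lt_add_of_pos_left K (mul_pos ha₁ (sub_pos.2 hxK))
    _ < f x := hside.1 x ⟨(le_max_right _ _).trans_lt hx, hxK⟩
    _ ≤ fMax f K := hf.le_fMax ⟨(le_max_left _ _).trans hx.le, hxK.le⟩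

theorem fMin_lt_K (hf : PositiveEquilibrium f K) {θ a₁ a₂ : ℝ} (hθ : 0 < θ) (ha₂ : 0 < a₂)
    (hside : SideSwitching f K θ a₁ a₂) (hK : K < fMax f K) : fMin f K < K := by
  obtain ⟨x, hKx, hx⟩ := exists_between (lt_min hK (lt_add_of_pos_right K hθ))
  calc fMin f K ≤ f x := hf.fMin_le_of_mem_Ioo ⟨hKx, hx.trans_le (min_le_left _ _)⟩
    _ < a₂ * (K - x) + K := hside.2 x ⟨hKx, hx.trans_le (min_le_right _ _)⟩
    _ < K := add_lt_of_neg_left K (mul_neg_of_pos_of_neg ha₂ (sub_neg.2 hKx))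

theorem mem_stabilizing_of_le (hf : PositiveEquilibrium f K) (h : β ∈ stabilizing f K)
    (hle : β ≤ β') (hβ' : β' < 1) : β' ∈ stabilizing f K := by
  obtain ⟨hβ, hleft, hright⟩ := h
  have hβ'0 : β' ∈ Ioo (0 : ℝ) 1 := ⟨hβ.1.trans_le hle, hβ'⟩
  refine ⟨hβ'0, fun x hx => ?_, fun x hx => ?_⟩
  · have hx0 : 0 < x := hf.fMin_nonneg.trans_lt hx.1
    have hGx : x < G f β' x := hf.lt_G hβ' ⟨hx0, hx.2⟩
    exact lt_apply_apply_of_le (continuousOn_G (hf.continuousOn_Icc hx0.le K) β) (hf.G_K β) hx.2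
      (fun z hz => hleft z ⟨hx.1.trans_le hz.1, hz.2⟩) hGx
      (G_le_G_of_le_map hle (hf.le_map ⟨hx0, hx.2.le⟩))
      (fun hK => hf.le_G hβ' ⟨hx0.trans hGx, hK⟩)
      (fun hK => G_le_G_of_map_le hle (hf.map_le hK.le))
  · have hx0 : 0 < x := hf.K_pos.trans hx.1
    have hGpos : 0 < G f β' x := hf.G_pos ⟨hβ'0.1.le, hβ'⟩ hx0
    have hcont : ContinuousOn (X := ℝᵒᵈ) (Y := ℝᵒᵈ) (G f β) (Icc x K) :=
      (continuousOn_G (hf.continuousOn_Icc hf.K_pos.le x) β).mono fun z hz => ⟨hz.2, hz.1⟩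
    exact lt_apply_apply_of_le (X := ℝᵒᵈ) hcont (hf.G_K β) hx.1
      (fun z hz => hright z ⟨hz.2, lt_of_le_of_lt hz.1 hx.2⟩) (hf.G_lt hβ' hx.1)
      (G_le_G_of_map_le hle (hf.map_le hx.1.le))
      (fun hK => hf.G_le hβ' hK)
      (fun hK => G_le_G_of_le_map hle (hf.le_map ⟨hGpos, le_of_lt hK⟩))

theorem mem_stabilizing_of_betaStar_lt (hf : PositiveEquilibrium f K) (h0 : 0 < betaStar f K)
    (h : betaStar f K < β) (hβ : β < 1) : β ∈ stabilizing f K := by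
  have hne : (stabilizing f K).Nonempty := by
    by_contra hempty
    rw [betaStar, not_nonempty_iff_eq_empty.1 hempty, Real.sInf_empty] at h0
    exact h0.false
  obtain ⟨β₀, hβ₀, hlt⟩ := exists_lt_of_csInf_lt hne h
  exact hf.mem_stabilizing_of_le hβ₀ hlt.le hβ

theorem G_le_fMax (hf : PositiveEquilibrium f K) (hβ : β ∈ Ico 0 1)
    (hx : x ∈ Icc 0 (fMax f K)) : G f β x ≤ fMax f K := by
  rcases le_total x K with h | h
  · exact (convex_Iic (fMax f K)) (hf.le_fMax ⟨hx.1, h⟩) hx.2 (sub_nonneg.2 hβ.2.le) hβ.1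
      (sub_add_cancel 1 β)
  · exact (hf.G_le hβ.2 h).trans hx.2

theorem fMin_le_G (hf : PositiveEquilibrium f K) (hβ : β ∈ Ico 0 1) (hK : K < fMax f K)
    (hx : x ∈ Icc (fMin f K) (fMax f K)) : fMin f K ≤ G f β x := by
  rcases le_total x K with h | h
  · exact hx.1.trans (hf.le_G hβ.2 ⟨(hf.fMin_pos hK).trans_le hx.1, h⟩)
  · exact (convex_Ici (fMin f K)) (hf.fMin_le hK ⟨h, hx.2⟩) hx.1 (sub_nonneg.2 hβ.2.le) hβ.1
      (sub_add_cancel 1 β)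

theorem G_mem_Icc (hf : PositiveEquilibrium f K) (hβ : β ∈ Ico 0 1) (hK : K < fMax f K)
    (hx : x ∈ Icc (fMin f K) (fMax f K)) : G f β x ∈ Icc (fMin f K) (fMax f K) :=
  ⟨hf.fMin_le_G hβ hK hx, hf.G_le_fMax hβ ⟨hf.fMin_nonneg.trans hx.1, hx.2⟩⟩

theorem G_mem_Ioo (hf : PositiveEquilibrium f K) (hβ : β ∈ Ioo 0 1) (hK : K < fMax f K)
    (hKmin : fMin f K < K) (hx : x ∈ Icc (fMin f K) (fMax f K)) :
    G f β x ∈ Ioo (fMin f K) (fMax f K) := by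
  have hβ' : 0 < 1 - β := sub_pos.2 hβ.2
  rcases lt_trichotomy x K with h | rfl | h
  · refine ⟨hx.1.trans_lt (hf.lt_G hβ.2 ⟨(hf.fMin_pos hK).trans_le hx.1, h⟩), ?_⟩
    calc G f β x < (1 - β) * fMax f K + β * fMax f K :=
          add_lt_add_of_le_of_lt (by gcongr; exact hf.le_fMax ⟨hf.fMin_nonneg.trans hx.1, h.le⟩)
            (mul_lt_mul_of_pos_left (h.trans hK) hβ.1)
      _ = fMax f K := by ring
  · rw [hf.G_K]
    exact ⟨hKmin, hK⟩
  · refine ⟨?_, (hf.G_lt hβ.2 h).trans_le hx.2⟩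
    calc fMin f K = (1 - β) * fMin f K + β * fMin f K := by ring
      _ < G f β x := add_lt_add_of_le_of_lt (by gcongr; exact hf.fMin_le hK ⟨h.le, hx.2⟩)
          (mul_lt_mul_of_pos_left (hKmin.trans h) hβ.1)

end PositiveEquilibrium

end ControlledMap

section Trajectories

/-- Solutions `y` of the difference equation driven by a deterministic sequence of controls `b`. -/
def IsTrajectory (f : ℝ → ℝ) (b y : ℕ → ℝ) : Prop :=
  ∀ n, y (n + 1) = G f (b n) (y n)

variable {f : ℝ → ℝ} {K B : ℝ} {b y : ℕ → ℝ}

theorem IsTrajectory.shift (hy : IsTrajectory f b y) (k : ℕ) :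
    IsTrajectory f (fun n => b (k + n)) fun n => y (k + n) :=
  fun n => hy (k + n)

theorem IsTrajectory.mem_of_mapsTo {S : Set ℝ} (hy : IsTrajectory f b y)
    (hS : ∀ n, MapsTo (G f (b n)) S S) (h0 : y 0 ∈ S) (n : ℕ) : y n ∈ S := by
  induction n with
  | zero => exact h0
  | succ n ih => exact hy n ▸ hS n ih

namespace PositiveEquilibrium

theorem eq_K_of_tendsto (hf : PositiveEquilibrium f K) (hB : B < 1) (hb : ∀ n, b n ≤ B)
    (hy : IsTrajectory f b y) {l : ℝ} (hl : 0 < l) (hlim : Tendsto y atTop (𝓝 l)) : l = K := by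
  have hfl : Tendsto (fun n => (1 - B) * |f (y n) - y n|) atTop (𝓝 ((1 - B) * |f l - l|)) :=
    (((hf.continuousOn.continuousAt (Ici_mem_nhds hl)).tendsto.comp hlim).sub hlim).abs.const_mul _
  have hincr : Tendsto (fun n => |y (n + 1) - y n|) atTop (𝓝 0) := by
    simpa only [Function.comp_apply, sub_self, abs_zero] using
      ((hlim.comp (tendsto_add_atTop_nat 1)).sub hlim).abs
  have hle : (1 - B) * |f l - l| ≤ 0 := le_of_tendsto_of_tendsto' hfl hincr fun n => by
    rw [hy n, G_sub_self, abs_mul]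
    gcongr
    exact (sub_le_sub_left (hb n) 1).trans (le_abs_self _)
  have habs : |f l - l| ≤ 0 := nonpos_of_mul_nonpos_right hle (sub_pos.2 hB)
  exact hf.eq_K_of_map_eq hl (sub_eq_zero.1 (abs_nonpos_iff.1 habs))

theorem exists_le_of_K_lt (hf : PositiveEquilibrium f K) (hB : B < 1) (hb : ∀ n, b n ≤ B)
    (hy : IsTrajectory f b y) {c : ℝ} (hc : K < c) : ∃ n, y n ≤ c := by
  by_contra! hlt
  have hanti : Antitone y := antitone_nat_of_succ_le fun n => by
    rw [hy n]
    exact hf.G_le ((hb n).trans_lt hB) (hc.trans (hlt n)).le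
  have hlim := tendsto_atTop_ciInf hanti ⟨c, forall_mem_range.2 fun n => (hlt n).le⟩
  have hge : K < ⨅ n, y n := hc.trans_le (ge_of_tendsto' hlim fun n => (hlt n).le)
  exact hge.ne' (hf.eq_K_of_tendsto hB hb hy (hf.K_pos.trans hge) hlim)

theorem exists_ge_of_lt_K (hf : PositiveEquilibrium f K) (hB : B < 1) (hb : ∀ n, b n ≤ B)
    (hy : IsTrajectory f b y) (hpos : ∀ n, 0 < y n) {c : ℝ} (hc : c < K) : ∃ n, c ≤ y n := by
  by_contra! hlt
  have hmono : Monotone y := monotone_nat_of_le_succ fun n => by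
    rw [hy n]
    exact hf.le_G ((hb n).trans_lt hB) ⟨hpos n, ((hlt n).trans hc).le⟩
  have hlim := tendsto_atTop_ciSup hmono ⟨c, forall_mem_range.2 fun n => (hlt n).le⟩
  have hle : ⨆ n, y n < K := (le_of_tendsto' hlim fun n => (hlt n).le).trans_lt hc
  have hsup : 0 < ⨆ n, y n := (hpos 0).trans_le (hmono.ge_of_tendsto hlim 0)
  exact hle.ne (hf.eq_K_of_tendsto hB hb hy hsup hlim)

theorem exists_forall_mem_Icc (hf : PositiveEquilibrium f K) (hB : B < 1)
    (hb : ∀ n, b n ∈ Icc 0 B) (hy : IsTrajectory f b y) (hy0 : 0 < y 0) (hK : K < fMax f K)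
    (hKmin : fMin f K < K) : ∃ k, ∀ n, y (k + n) ∈ Icc (fMin f K) (fMax f K) := by
  have hb1 : ∀ n, b n ∈ Ico 0 1 := fun n => ⟨(hb n).1, (hb n).2.trans_lt hB⟩
  have hpos : ∀ n, 0 < y n := hy.mem_of_mapsTo (S := Ioi 0) (fun n x => hf.G_pos (hb1 n)) hy0
  obtain ⟨k, hk⟩ := hf.exists_le_of_K_lt hB (fun n => (hb n).2) hy hK
  have hle : ∀ n, y (k + n) ∈ Ioc 0 (fMax f K) := (hy.shift k).mem_of_mapsTo
    (fun n x hx => ⟨hf.G_pos (hb1 _) hx.1, hf.G_le_fMax (hb1 _) ⟨hx.1.le, hx.2⟩⟩) ⟨hpos k, hk⟩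
  obtain ⟨m, hm⟩ := hf.exists_ge_of_lt_K hB (fun n => (hb (k + n)).2) (hy.shift k)
    (fun n => hpos (k + n)) hKmin
  exact ⟨k + m, (hy.shift (k + m)).mem_of_mapsTo (fun n x => hf.G_mem_Icc (hb1 _) hK)
    ⟨hm, (hle m).2⟩⟩

end PositiveEquilibrium

theorem exists_forall_dist_iterate_lt {P X : Type*} [PseudoMetricSpace P] [PseudoMetricSpace X]
    {g : P → X → X} {t : Set P} {s : Set X} (ht : IsCompact t) (hs : IsCompact s)
    (hg : ContinuousOn (Function.uncurry g) (t ×ˢ s)) {β : P} (hβ : β ∈ t)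
    (hmaps : MapsTo (g β) s s) (N : ℕ) {η : ℝ} (hη : 0 < η) :
    ∃ ε > 0, ∀ (b : ℕ → P) (y : ℕ → X), (∀ n, y (n + 1) = g (b n) (y n)) → (∀ n, b n ∈ t) →
      (∀ n, y n ∈ s) → (∀ n < N, dist (b n) β < ε) → dist (y N) ((g β)^[N] (y 0)) < η := by
  induction N generalizing η with
  | zero => exact ⟨1, one_pos, fun b y _ _ _ _ => by simpa using hη⟩
  | succ N ih =>
    obtain ⟨δ, hδ, hunif⟩ := Metric.uniformContinuousOn_iff.1
      ((ht.prod hs).uniformContinuousOn_of_continuous hg) η hη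
    obtain ⟨ε, hε, hnear⟩ := ih hδ
    refine ⟨min ε δ, lt_min hε hδ, fun b y hy hb hys hbβ => ?_⟩
    rw [hy N, Function.iterate_succ_apply']
    refine hunif (b N, y N) ⟨hb N, hys N⟩ (β, _) ⟨hβ, hmaps.iterate N (hys 0)⟩ (max_lt ?_ ?_)
    · exact (hbβ N N.lt_succ_self).trans_le (min_le_right _ _)
    · exact hnear b y hy hb hys fun n hn =>
        (hbβ n (hn.trans N.lt_succ_self)).trans_le (min_le_left _ _)

theorem continuousOn_uncurry_G {s t : Set ℝ} (hf : ContinuousOn f s) :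
    ContinuousOn (Function.uncurry (G f)) (t ×ˢ s) := by
  have hfsnd : ContinuousOn (fun p : ℝ × ℝ => f p.2) (t ×ˢ s) :=
    hf.comp continuousOn_snd fun p hp => hp.2
  exact ((continuousOn_const.sub continuousOn_fst).mul hfsnd).add
    (continuousOn_fst.mul continuousOn_snd)

theorem PositiveEquilibrium.exists_dist_lt_of_dist_control_lt (hf : PositiveEquilibrium f K)
    (hBs : B ∈ stabilizing f K) (hK : K < fMax f K) (hKmin : fMin f K < K) {δ : ℝ} (hδ : 0 < δ) :
    ∃ N, ∃ ε > 0, ∀ b y, IsTrajectory f b y → (∀ n, b n ∈ Icc 0 B) →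
      (∀ n, y n ∈ Icc (fMin f K) (fMax f K)) → (∀ n < N, dist (b n) B < ε) →
        dist (y N) K < δ := by
  have hfc : ContinuousOn f (Icc (fMin f K) (fMax f K)) := hf.continuousOn_Icc hf.fMin_nonneg _
  have hmaps : MapsTo (G f B) (Icc (fMin f K) (fMax f K)) (Ioo (fMin f K) (fMax f K)) :=
    fun x hx => hf.G_mem_Ioo hBs.1 hK hKmin hx
  obtain ⟨N, hN⟩ := exists_iterate_mapsTo_of_lt_apply_apply (continuousOn_G hfc B) hmaps hK.le
    (hf.G_K B) (fun z hz => hf.lt_G hBs.1.2 ⟨hf.fMin_nonneg.trans_lt hz.1, hz.2⟩)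
    (fun z hz => hf.G_lt hBs.1.2 hz.1) hBs.2.1 Metric.isOpen_ball
    (Metric.mem_ball_self (half_pos hδ))
  obtain ⟨ε, hε, hnear⟩ := exists_forall_dist_iterate_lt isCompact_Icc isCompact_Icc
    (continuousOn_uncurry_G hfc) (right_mem_Icc.2 hBs.1.1.le)
    (hmaps.mono_right Ioo_subset_Icc_self) N (half_pos hδ)
  refine ⟨N, ε, hε, fun b y hy hb hmem hbB => ?_⟩
  calc dist (y N) K ≤ dist (y N) ((G f B)^[N] (y 0)) + dist ((G f B)^[N] (y 0)) K :=
        dist_triangle _ _ _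
    _ < δ / 2 + δ / 2 := add_lt_add (hnear b y hy hb hmem hbB) (hN (hmem 0))
    _ = δ := add_halves δ

end Trajectories

section LocalContraction

theorem mem_and_dist_le_prod {X : Type*} [PseudoMetricSpace X] {K : X} {θ C : ℝ}
    {g : ℕ → X → X} {S : ℕ → Set X} {r : ℕ → ℝ} {y : ℕ → X} (hr : ∀ n, 0 ≤ r n)
    (hstep : ∀ n, ∀ x ∈ S n, dist x K < θ → g n x ∈ S (n + 1) ∧ dist (g n x) K ≤ r n * dist x K)
    (hy : ∀ n, y (n + 1) = g n (y n)) (hy0 : y 0 ∈ S 0)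
    (hC : ∀ n, ∏ i ∈ Finset.range n, r i ≤ C) (hθ : C * dist (y 0) K < θ) (n : ℕ) :
    y n ∈ S n ∧ dist (y n) K ≤ (∏ i ∈ Finset.range n, r i) * dist (y 0) K := by
  induction n with
  | zero => simpa using hy0
  | succ n ih =>
    obtain ⟨hmem, hdist⟩ := ih
    have hnear : dist (y n) K < θ :=
      (hdist.trans (mul_le_mul_of_nonneg_right (hC n) dist_nonneg)).trans_lt hθ
    rw [hy n, Finset.prod_range_succ_comm, mul_assoc]
    exact ⟨(hstep n _ hmem hnear).1, (hstep n _ hmem hnear).2.trans <|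
      mul_le_mul_of_nonneg_left hdist (hr n)⟩

/-- The product of the contraction rates of the first `n` steps of a trajectory that alternates
between the two sides of `K`, the constant on its starting side being `L₀`. -/
def altProd (L₀ L₁ : ℝ) (b : ℕ → ℝ) (n : ℕ) : ℝ :=
  ∏ j ∈ Finset.range n, scrL (if Even j then L₀ else L₁) (b j)

/-- The control sequences that contract every alternating trajectory starting on the side with
constant `L₀`, expanding it by a factor of at most `C` on the way. -/
def contractingSet (L₀ L₁ C : ℝ) : Set (ℕ → ℝ) :=
  {b | (∀ n, altProd L₀ L₁ b n ≤ C) ∧ Tendsto (altProd L₀ L₁ b) atTop (𝓝 0)}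

variable {f : ℝ → ℝ} {K θ Lm Lp a₁ a₂ a L B β x : ℝ} {b y : ℕ → ℝ}

theorem IsTrajectory.tendsto_of_mem_contractingSet {S₀ S₁ : Set ℝ} {L₀ L₁ C : ℝ}
    (hL₀ : ∀ n, 0 ≤ scrL L₀ (b n)) (hL₁ : ∀ n, 0 ≤ scrL L₁ (b n))
    (h₀ : ∀ n, ∀ x ∈ S₀, dist x K < θ →
      G f (b n) x ∈ S₁ ∧ dist (G f (b n) x) K ≤ scrL L₀ (b n) * dist x K)
    (h₁ : ∀ n, ∀ x ∈ S₁, dist x K < θ →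
      G f (b n) x ∈ S₀ ∧ dist (G f (b n) x) K ≤ scrL L₁ (b n) * dist x K)
    (hy : IsTrajectory f b y) (hb : b ∈ contractingSet L₀ L₁ C) (hy0 : y 0 ∈ S₀)
    (hC : C * dist (y 0) K < θ) : Tendsto y atTop (𝓝 K) := by
  have hdist : ∀ n, dist (y n) K ≤ altProd L₀ L₁ b n * dist (y 0) K := fun n => by
    refine (mem_and_dist_le_prod (S := fun n => if Even n then S₀ else S₁) (fun n => ?_)
      (fun n x hx hxθ => ?_) hy (by simpa using hy0) hb.1 hC n).2
    · split_ifs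
      exacts [hL₀ n, hL₁ n]
    · rcases Nat.even_or_odd n with hn | hn
      · simp only [hn, Nat.even_add_one, not_true_eq_false, if_true, if_false] at hx ⊢
        exact h₀ n x hx hxθ
      · simp only [Nat.not_even_iff_odd.2 hn, Nat.even_add_one, not_false_eq_true, if_true,
          if_false] at hx ⊢
        exact h₁ n x hx hxθ
  exact tendsto_iff_dist_tendsto_zero.2 <| squeeze_zero (fun _ => dist_nonneg) hdist <| by
    simpa only [zero_mul] using hb.2.mul_const (dist (y 0) K)

theorem G_sub_sub_scrL_mul (f : ℝ → ℝ) (K L β x : ℝ) :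
    G f β x - K - scrL L β * (K - x) = (1 - β) * (f x - (L * (K - x) + K)) := by
  unfold G scrL; ring

theorem scrL_lt_scrL (hβ : β < 1) (h : a < L) : scrL a β < scrL L β :=
  sub_lt_sub_right (mul_lt_mul_of_pos_left h (sub_pos.2 hβ)) β

theorem scrL_antitone (hL : -1 ≤ L) : Antitone (scrL L) := fun β γ h => by
  have hmul : (L + 1) * β ≤ (L + 1) * γ := mul_le_mul_of_nonneg_left h (by linarith)
  unfold scrL
  linarith

theorem scrL_nonneg_of_le_div (ha : 0 < a + 1) (hβ : β ≤ a / (a + 1)) : 0 ≤ scrL a β := by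
  rw [le_div_iff₀ ha] at hβ
  unfold scrL
  linarith

theorem pos_of_scrL_nonneg (hB : B ∈ Ioo 0 1) (h : 0 ≤ scrL L B) : 0 < L :=
  pos_of_mul_pos_right (hB.1.trans_le (sub_nonneg.1 h)) (sub_nonneg.2 hB.2.le)

theorem scrL_mem_Icc (hB : B ∈ Ico 0 1) (h : 0 ≤ scrL L B) (hβ : β ∈ Icc 0 B) :
    scrL L β ∈ Icc (scrL L B) L := by
  have hL : 0 ≤ L := nonneg_of_mul_nonneg_right (hB.1.trans (sub_nonneg.1 h)) (sub_pos.2 hB.2)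
  have hanti := scrL_antitone (neg_one_lt_zero.le.trans hL)
  exact ⟨hanti hβ.2, (hanti hβ.1).trans_eq (by unfold scrL; ring)⟩

theorem SideSwitching.lt_left (hside : SideSwitching f K θ a₁ a₂) (hθ : 0 < θ)
    (hloc : LocalLipschitz f K θ Lm Lp) : a₁ < Lm := by
  obtain ⟨x, hx, hxK⟩ := exists_between (sub_lt_self K hθ)
  have hlt : a₁ * (K - x) < Lm * (K - x) :=
    (lt_sub_iff_add_lt.2 (hside.1 x ⟨hx, hxK⟩)).trans_le (hloc.1 x ⟨hx.le, hxK.le⟩)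
  exact lt_of_mul_lt_mul_right hlt (sub_nonneg.2 hxK.le)

theorem SideSwitching.lt_right (hside : SideSwitching f K θ a₁ a₂) (hθ : 0 < θ)
    (hloc : LocalLipschitz f K θ Lm Lp) : a₂ < Lp := by
  obtain ⟨x, hKx, hx⟩ := exists_between (lt_add_of_pos_right K hθ)
  have hlt : a₂ * (x - K) < Lp * (x - K) := by
    linarith [hside.2 x ⟨hKx, hx⟩, hloc.2 x ⟨hKx.le, hx.le⟩]
  exact lt_of_mul_lt_mul_right hlt (sub_nonneg.2 hKx.le)

theorem K_lt_G_and_dist_le (hloc : LocalLipschitz f K θ Lm Lp)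
    (hside : SideSwitching f K θ a₁ a₂) (hβ : β < 1) (ha₁ : 0 ≤ scrL a₁ β) (hx : x < K)
    (hxθ : dist x K < θ) : K < G f β x ∧ dist (G f β x) K ≤ scrL Lm β * dist x K := by
  have hdist : dist x K = K - x := by rw [dist_comm, Real.dist_eq, abs_of_pos (sub_pos.2 hx)]
  have hxl : K - θ < x := sub_lt_comm.1 (hdist ▸ hxθ)
  have hlower : scrL a₁ β * (K - x) < G f β x - K := by
    rw [← sub_pos, G_sub_sub_scrL_mul]
    exact mul_pos (sub_pos.2 hβ) (sub_pos.2 (hside.1 x ⟨hxl, hx⟩))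
  have hupper : G f β x - K ≤ scrL Lm β * (K - x) := by
    rw [← sub_nonpos, G_sub_sub_scrL_mul]
    exact mul_nonpos_of_nonneg_of_nonpos (sub_nonneg.2 hβ.le)
      (sub_nonpos.2 (sub_le_iff_le_add.1 (hloc.1 x ⟨hxl.le, hx.le⟩)))
  have hK : 0 < G f β x - K := (mul_nonneg ha₁ (sub_nonneg.2 hx.le)).trans_lt hlower
  exact ⟨sub_pos.1 hK, by rwa [hdist, Real.dist_eq, abs_of_pos hK]⟩

theorem G_lt_K_and_dist_le (hloc : LocalLipschitz f K θ Lm Lp)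
    (hside : SideSwitching f K θ a₁ a₂) (hβ : β < 1) (ha₂ : 0 ≤ scrL a₂ β) (hx : K < x)
    (hxθ : dist x K < θ) : G f β x < K ∧ dist (G f β x) K ≤ scrL Lp β * dist x K := by
  have hdist : dist x K = x - K := by rw [Real.dist_eq, abs_of_pos (sub_pos.2 hx)]
  have hxr : x < K + θ := sub_lt_iff_lt_add'.1 (hdist ▸ hxθ)
  have hupper : G f β x - K < scrL a₂ β * (K - x) := by
    rw [← sub_neg, G_sub_sub_scrL_mul]
    exact mul_neg_of_pos_of_neg (sub_pos.2 hβ) (sub_neg.2 (hside.2 x ⟨hx, hxr⟩))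
  have hlower : scrL Lp β * (K - x) ≤ G f β x - K := by
    rw [← sub_nonneg, G_sub_sub_scrL_mul]
    exact mul_nonneg (sub_nonneg.2 hβ.le) (by linarith [hloc.2 x ⟨hx.le, hxr.le⟩])
  have hK : G f β x - K < 0 :=
    hupper.trans_le (mul_nonpos_of_nonneg_of_nonpos ha₂ (sub_nonpos.2 hx.le))
  refine ⟨sub_neg.1 hK, ?_⟩
  rw [hdist, Real.dist_eq, abs_of_neg hK]
  linarith

theorem IsTrajectory.tendsto_of_dist_lt (hfK : f K = K) (hθ : 0 < θ)
    (hloc : LocalLipschitz f K θ Lm Lp) (hside : SideSwitching f K θ a₁ a₂) (hB : B ∈ Ico 0 1)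
    (ha₁ : 0 ≤ scrL a₁ B) (ha₂ : 0 ≤ scrL a₂ B) (hb : ∀ n, b n ∈ Icc 0 B)
    (hy : IsTrajectory f b y) {C : ℝ}
    (hbC : b ∈ contractingSet Lm Lp C ∩ contractingSet Lp Lm C) (hC : C * dist (y 0) K < θ) :
    Tendsto y atTop (𝓝 K) := by
  have hb1 : ∀ n, b n < 1 := fun n => (hb n).2.trans_lt hB.2
  have ha₁b : ∀ n, 0 ≤ scrL a₁ (b n) := fun n => ha₁.trans (scrL_mem_Icc hB ha₁ (hb n)).1
  have ha₂b : ∀ n, 0 ≤ scrL a₂ (b n) := fun n => ha₂.trans (scrL_mem_Icc hB ha₂ (hb n)).1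
  have hLm : ∀ n, 0 ≤ scrL Lm (b n) := fun n =>
    (ha₁b n).trans (scrL_lt_scrL (hb1 n) (hside.lt_left hθ hloc)).le
  have hLp : ∀ n, 0 ≤ scrL Lp (b n) := fun n =>
    (ha₂b n).trans (scrL_lt_scrL (hb1 n) (hside.lt_right hθ hloc)).le
  have hl := fun n x => K_lt_G_and_dist_le (x := x) hloc hside (hb1 n) (ha₁b n)
  have hr := fun n x => G_lt_K_and_dist_le (x := x) hloc hside (hb1 n) (ha₂b n)
  rcases lt_trichotomy (y 0) K with h | h | h
  · exact hy.tendsto_of_mem_contractingSet (S₀ := Iio K) (S₁ := Ioi K) hLm hLp hl hr hbC.1 h hC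
  · have hconst := hy.mem_of_mapsTo (S := {K})
      (fun n => mapsTo_singleton.2 (G_eq_of_map_eq hfK _)) h
    exact tendsto_const_nhds.congr fun n => (hconst n).symm
  · exact hy.tendsto_of_mem_contractingSet (S₀ := Ioi K) (S₁ := Iio K) hLp hLm hr hl hbC.2 h hC

end LocalContraction

section IIDSequences

theorem sum_range_ite_even {M : Type*} [AddCommMonoid M] (u v : ℕ → M) (n : ℕ) :
    ∑ j ∈ Finset.range n, (if Even j then u j else v j) =
      ∑ i ∈ Finset.range (n - n / 2), u (2 * i) + ∑ i ∈ Finset.range (n / 2), v (2 * i + 1) := by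
  induction n with
  | zero => simp
  | succ n ih =>
    rw [Finset.sum_range_succ, ih]
    rcases Nat.even_or_odd' n with ⟨m, rfl | rfl⟩
    · rw [if_pos (even_two_mul m), show 2 * m + 1 - (2 * m + 1) / 2 = m + 1 by omega,
        show 2 * m - 2 * m / 2 = m by omega, show (2 * m + 1) / 2 = m by omega,
        show 2 * m / 2 = m by omega, Finset.sum_range_succ, add_right_comm]
    · rw [if_neg (by simp), show 2 * m + 1 + 1 - (2 * m + 1 + 1) / 2 = m + 1 by omega,
        show 2 * m + 1 - (2 * m + 1) / 2 = m + 1 by omega,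
        show (2 * m + 1 + 1) / 2 = m + 1 by omega, show (2 * m + 1) / 2 = m by omega,
        Finset.sum_range_succ (fun i => v (2 * i + 1)), add_assoc]

theorem tendsto_average_ite_even {u v : ℕ → ℝ} {a c : ℝ}
    (hu : Tendsto (fun n : ℕ => (∑ i ∈ Finset.range n, u (2 * i)) / n) atTop (𝓝 a))
    (hv : Tendsto (fun n : ℕ => (∑ i ∈ Finset.range n, v (2 * i + 1)) / n) atTop (𝓝 c)) :
    Tendsto (fun n : ℕ => (∑ j ∈ Finset.range n, if Even j then u j else v j) / n) atTop
      (𝓝 ((a + c) / 2)) := by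
  have hhalf : Tendsto (fun n : ℕ => ((n / 2 : ℕ) : ℝ) / n) atTop (𝓝 (1 / 2)) := by
    refine ((tendsto_nat_floor_mul_div_atTop (R := ℝ) one_half_pos.le).comp
      tendsto_natCast_atTop_atTop).congr fun n => ?_
    rw [Function.comp_apply, one_div_mul_eq_div, ← Nat.cast_two, Nat.floor_div_natCast,
      Nat.floor_natCast]
  have hcohalf : Tendsto (fun n : ℕ => ((n - n / 2 : ℕ) : ℝ) / n) atTop (𝓝 (1 - 1 / 2)) := by
    refine (hhalf.const_sub 1).congr' ?_
    filter_upwards [eventually_ne_atTop 0] with n hn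
    rw [Nat.cast_sub (Nat.div_le_self n 2), sub_div, div_self (Nat.cast_ne_zero.2 hn)]
  have htop : Tendsto (fun n : ℕ => n / 2) atTop atTop := Nat.tendsto_div_const_atTop two_ne_zero
  have hcotop : Tendsto (fun n : ℕ => n - n / 2) atTop atTop :=
    tendsto_atTop_mono (fun n => by omega) htop
  have hlim := ((hu.comp hcotop).mul hcohalf).add ((hv.comp htop).mul hhalf)
  rw [show a * (1 - 1 / 2) + c * (1 / 2) = (a + c) / 2 by ring] at hlim
  refine hlim.congr' ?_
  filter_upwards [eventually_ge_atTop 2] with n hn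
  have h₁ : ((n - n / 2 : ℕ) : ℝ) ≠ 0 := Nat.cast_ne_zero.2 (by omega)
  have h₂ : ((n / 2 : ℕ) : ℝ) ≠ 0 := Nat.cast_ne_zero.2 (by omega)
  rw [Function.comp_apply, Function.comp_apply, div_mul_div_cancel₀ h₁, div_mul_div_cancel₀ h₂,
    ← add_div, sum_range_ite_even]

theorem measure_le_measure_limsup {Ω : Type*} [MeasurableSpace Ω] {μ : Measure Ω}
    [IsFiniteMeasure μ] {A : ℕ → Set Ω} (hA : ∀ n, NullMeasurableSet (A n) μ) {c : ENNReal}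
    (hc : ∀ n, c ≤ μ (A n)) : c ≤ μ (limsup A atTop) := by
  have hanti : Antitone fun m => ⋃ n ≥ m, A n := fun _ _ hkm =>
    biUnion_subset_biUnion_left fun _ hn => le_trans hkm hn
  have hmeas : ∀ m, NullMeasurableSet (⋃ n ≥ m, A n) μ := fun m =>
    NullMeasurableSet.biUnion (to_countable {n | n ≥ m}) fun n _ => hA n
  rw [limsup_eq_iInf_iSup_of_nat]
  exact ge_of_tendsto' (tendsto_measure_iInter_atTop hmeas hanti ⟨0, measure_ne_top _ _⟩) fun m =>
    (hc m).trans (measure_mono (subset_biUnion_of_mem (u := A) (le_refl m)))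

theorem measurableSet_limsup_of_tail {Ω : Type*} {m : ℕ → MeasurableSpace Ω} {A : ℕ → Set Ω}
    (hA : ∀ k, MeasurableSet[⨆ i ≥ k, m i] (A k)) :
    MeasurableSet[limsup m atTop] (limsup A atTop) := by
  rw [limsup_eq_iInf_iSup_of_nat, MeasurableSpace.measurableSet_iInf]
  intro k
  rw [← limsup_nat_add A k]
  refine @MeasurableSet.measurableSet_limsup Ω (⨆ i ≥ k, m i) _ fun n => ?_
  have hle : ⨆ i ≥ n + k, m i ≤ ⨆ i ≥ k, m i :=
    biSup_mono fun _ hi => (Nat.le_add_left k n).trans hi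
  exact hle _ (hA (n + k))

theorem measurable_iSup_comap_shift {Ω E : Type*} [MeasurableSpace E] (X : ℕ → Ω → E) {m k : ℕ}
    (h : m ≤ k) :
    Measurable[⨆ i ≥ m, MeasurableSpace.comap (X i) inferInstance] fun ω n => X (k + n) ω := by
  rw [@measurable_pi_iff]
  exact fun n => (comap_measurable (X (k + n))).mono
    (le_iSup₂_of_le (k + n) (h.trans (Nat.le_add_right k n)) le_rfl) le_rfl

variable {Ω E : Type*} [MeasurableSpace Ω] [MeasurableSpace E] {μ : Measure Ω} {X : ℕ → Ω → E}

theorem ae_tendsto_average_comp_of_injective (hindep : iIndepFun X μ)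
    (hid : ∀ n, IdentDistrib (X n) (X 0) μ μ) {φ : E → ℝ} (hφ : Measurable φ)
    (hint : Integrable (fun ω => φ (X 0 ω)) μ) {τ : ℕ → ℕ} (hτ : Function.Injective τ) :
    ∀ᵐ ω ∂μ, Tendsto (fun n : ℕ => (∑ i ∈ Finset.range n, φ (X (τ i) ω)) / n) atTop
      (𝓝 (∫ ω, φ (X 0 ω) ∂μ)) := by
  have hidφ : ∀ i, IdentDistrib (fun ω => φ (X i ω)) (fun ω => φ (X 0 ω)) μ μ :=
    fun i => (hid i).comp hφ
  have hlaw := strong_law_ae_real (fun i ω => φ (X (τ i) ω))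
    ((hidφ (τ 0)).integrable_iff.2 hint)
    (fun i j hij => (hindep.indepFun (hτ.ne hij)).comp hφ hφ)
    (fun i => (hidφ (τ i)).trans (hidφ (τ 0)).symm)
  rwa [(hidφ (τ 0)).integral_eq] at hlaw

theorem ae_tendsto_sum_ite_even_atBot (hindep : iIndepFun X μ)
    (hid : ∀ n, IdentDistrib (X n) (X 0) μ μ) {φ ψ : E → ℝ} (hφ : Measurable φ)
    (hψ : Measurable ψ) (hφi : Integrable (fun ω => φ (X 0 ω)) μ)
    (hψi : Integrable (fun ω => ψ (X 0 ω)) μ)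
    (hneg : ∫ ω, φ (X 0 ω) ∂μ + ∫ ω, ψ (X 0 ω) ∂μ < 0) :
    ∀ᵐ ω ∂μ, Tendsto (fun n => ∑ j ∈ Finset.range n, if Even j then φ (X j ω) else ψ (X j ω))
      atTop atBot := by
  have heven : Function.Injective fun i : ℕ => 2 * i := fun i j h => by grind
  have hodd : Function.Injective fun i : ℕ => 2 * i + 1 := fun i j h => by grind
  filter_upwards [ae_tendsto_average_comp_of_injective hindep hid hφ hφi heven,
    ae_tendsto_average_comp_of_injective hindep hid hψ hψi hodd] with ω hu hv
  have havg := tendsto_average_ite_even (u := fun j => φ (X j ω)) (v := fun j => ψ (X j ω)) hu hv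
  have hmean : (∫ ω, φ (X 0 ω) ∂μ + ∫ ω, ψ (X 0 ω) ∂μ) / 2 < 0 := div_neg_of_neg_of_pos hneg two_pos
  refine (havg.neg_mul_atTop hmean tendsto_natCast_atTop_atTop).congr' ?_
  filter_upwards [eventually_ne_atTop 0] with n hn
  exact div_mul_cancel₀ _ (Nat.cast_ne_zero.2 hn)

theorem identDistrib_shift (hX : ∀ n, Measurable (X n)) (hindep : iIndepFun X μ)
    (hid : ∀ n, IdentDistrib (X n) (X 0) μ μ) (k : ℕ) :
    IdentDistrib (fun ω n => X (k + n) ω) (fun ω n => X n ω) μ μ where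
  aemeasurable_fst := (measurable_pi_iff.2 fun n => hX (k + n)).aemeasurable
  aemeasurable_snd := (measurable_pi_iff.2 hX).aemeasurable
  map_eq := by
    rw [iIndepFun.map_fun_eq_infinitePi_map (X := fun n => X (k + n)) (fun n => hX (k + n))
        (hindep.precomp (add_right_injective k)),
      iIndepFun.map_fun_eq_infinitePi_map hX hindep]
    congr 1 with n : 1
    exact (hid (k + n)).map_eq.trans (hid n).map_eq.symm

theorem ae_frequently_shift_mem (hX : ∀ n, Measurable (X n)) (hindep : iIndepFun X μ)
    (hid : ∀ n, IdentDistrib (X n) (X 0) μ μ) {D : Set (ℕ → E)} (hD : MeasurableSet D)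
    (hpos : 0 < μ {ω | (fun n => X n ω) ∈ D}) :
    ∀ᵐ ω ∂μ, ∃ᶠ k in atTop, (fun n => X (k + n) ω) ∈ D := by
  have := hindep.isProbabilityMeasure
  set A : ℕ → Set Ω := fun k => (fun ω n => X (k + n) ω) ⁻¹' D
  have hA : ∀ k, MeasurableSet (A k) := fun k =>
    measurable_pi_iff.2 (fun n => hX (k + n)) hD
  have hAμ : ∀ k, μ (A k) = μ {ω | (fun n => X n ω) ∈ D} := fun k =>
    (identDistrib_shift hX hindep hid k).measure_mem_eq hD
  have hlimsup : μ (limsup A atTop) ≠ 0 := (hpos.trans_le <|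
    measure_le_measure_limsup (fun k => (hA k).nullMeasurableSet) fun k => (hAμ k).ge).ne'
  have htail : MeasurableSet[limsup (fun i => MeasurableSpace.comap (X i) inferInstance) atTop]
      (limsup A atTop) :=
    measurableSet_limsup_of_tail fun k => measurable_iSup_comap_shift X (le_refl k) hD
  have hone : μ (limsup A atTop) = 1 :=
    (measure_zero_or_one_of_measurableSet_limsup_atTop (fun n => (hX n).comap_le) hindep
      htail).resolve_left hlimsup
  filter_upwards [(mem_ae_iff_prob_eq_one (MeasurableSet.measurableSet_limsup hA)).2 hone]
    with ω hω
  exact mem_limsup_iff_frequently_mem.1 hω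

theorem measure_forall_lt_mem_pos (hindep : iIndepFun X μ)
    (hid : ∀ n, IdentDistrib (X n) (X 0) μ μ) {s : Set E} (hs : MeasurableSet s)
    (hpos : 0 < μ (X 0 ⁻¹' s)) (N : ℕ) : 0 < μ (⋂ n ∈ Finset.range N, X n ⁻¹' s) := by
  rw [hindep.measure_inter_preimage_eq_mul (sets := fun _ => s) _ fun _ _ => hs]
  refine pos_iff_ne_zero.2 (Finset.prod_ne_zero_iff.2 fun n _ => ?_)
  exact ((hid n).measure_mem_eq hs).trans_ne hpos.ne'

theorem measure_prefix_inter_shift_pos (hX : ∀ n, Measurable (X n)) (hindep : iIndepFun X μ)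
    (hid : ∀ n, IdentDistrib (X n) (X 0) μ μ) {s : Set E} (hs : MeasurableSet s)
    (hspos : 0 < μ (X 0 ⁻¹' s)) {D : Set (ℕ → E)} (hD : MeasurableSet D)
    (hDpos : 0 < μ {ω | (fun n => X n ω) ∈ D}) (N : ℕ) :
    0 < μ {ω | (∀ n < N, X n ω ∈ s) ∧ (fun n => X (N + n) ω) ∈ D} := by
  have hind := indep_iSup_of_disjoint (fun n => (hX n).comap_le) hindep
    (disjoint_left.2 fun n (hn : n < N) (hn' : N ≤ n) => hn.not_ge hn')
  have hle : ∀ n < N, MeasurableSpace.comap (X n) inferInstance ≤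
      ⨆ i < N, MeasurableSpace.comap (X i) inferInstance :=
    fun n hn => le_iSup₂_of_le n hn le_rfl
  have hpre : MeasurableSet[⨆ i < N, MeasurableSpace.comap (X i) inferInstance]
      (⋂ n ∈ Finset.range N, X n ⁻¹' s) :=
    Finset.measurableSet_biInter _ fun n hn => hle n (Finset.mem_range.1 hn) _ ⟨s, hs, rfl⟩
  have hsplit : {ω | (∀ n < N, X n ω ∈ s) ∧ (fun n => X (N + n) ω) ∈ D} =
      (⋂ n ∈ Finset.range N, X n ⁻¹' s) ∩ (fun ω n => X (N + n) ω) ⁻¹' D := by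
    ext ω
    simp
  rw [hsplit, (Indep_iff _ _ μ).1 hind _ _ hpre (measurable_iSup_comap_shift X le_rfl hD)]
  refine ENNReal.mul_pos (measure_forall_lt_mem_pos hindep hid hs hspos N).ne' ?_
  exact ((identDistrib_shift hX hindep hid N).measure_mem_eq hD).trans_ne hDpos.ne'

theorem ae_frequently_forall_mem_and_shift_mem (hX : ∀ n, Measurable (X n))
    (hindep : iIndepFun X μ) (hid : ∀ n, IdentDistrib (X n) (X 0) μ μ) {s : Set E}
    (hs : MeasurableSet s) (hspos : 0 < μ (X 0 ⁻¹' s)) {D : Set (ℕ → E)} (hD : MeasurableSet D)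
    (hDpos : 0 < μ {ω | (fun n => X n ω) ∈ D}) (N : ℕ) :
    ∀ᵐ ω ∂μ, ∃ᶠ k in atTop,
      (∀ n < N, X (k + n) ω ∈ s) ∧ (fun n => X (k + (N + n)) ω) ∈ D := by
  refine ae_frequently_shift_mem hX hindep hid
    (D := {x | (∀ n < N, x n ∈ s) ∧ (fun n => x (N + n)) ∈ D}) ?_
    (measure_prefix_inter_shift_pos hX hindep hid hs hspos hD hDpos N)
  have hpre : MeasurableSet {x : ℕ → E | ∀ n < N, x n ∈ s} := by
    simp only [ofPred_forall]
    exact MeasurableSet.iInter fun n => MeasurableSet.iInter fun _ => measurable_pi_apply n hs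
  exact hpre.inter (measurable_pi_lambda _ (fun n => measurable_pi_apply (N + n)) hD)

end IIDSequences

section RandomControls

theorem measurable_scrL (L : ℝ) : Measurable (scrL L) := by
  unfold scrL
  fun_prop

theorem measurable_altProd (L₀ L₁ : ℝ) (n : ℕ) : Measurable fun b => altProd L₀ L₁ b n :=
  Finset.measurable_prod _ fun j _ => (measurable_scrL _).comp (measurable_pi_apply j)

theorem measurableSet_contractingSet (L₀ L₁ C : ℝ) : MeasurableSet (contractingSet L₀ L₁ C) := by
  have hbound : MeasurableSet {b | ∀ n, altProd L₀ L₁ b n ≤ C} := by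
    rw [ofPred_forall]
    exact MeasurableSet.iInter fun n => measurableSet_le (measurable_altProd L₀ L₁ n)
      measurable_const
  exact hbound.inter (measurableSet_tendsto (𝓝 0) fun n => measurable_altProd L₀ L₁ n)

theorem contractingSet_mono (L₀ L₁ : ℝ) : Monotone (contractingSet L₀ L₁) :=
  fun _ _ h _ hb => ⟨fun n => (hb.1 n).trans h, hb.2⟩

theorem exists_nat_mem_contractingSet {L₀ L₁ : ℝ} {b : ℕ → ℝ}
    (h : Tendsto (altProd L₀ L₁ b) atTop (𝓝 0)) : ∃ m : ℕ, b ∈ contractingSet L₀ L₁ m := by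
  obtain ⟨C, hC⟩ := h.bddAbove_range
  obtain ⟨m, hm⟩ := exists_nat_ge C
  exact ⟨m, fun n => (hC (mem_range_self n)).trans hm, h⟩

/-- Independent, identically distributed controls with values in `[0, B]` almost surely, whose law
charges every neighbourhood of `B`. -/
structure ControlAssumption {Ω : Type*} [MeasurableSpace Ω] (μ : Measure Ω) (b : ℕ → Ω → ℝ)
    (B : ℝ) : Prop where
  measurable : ∀ n, Measurable (b n)
  indep : iIndepFun b μ
  identDistrib : ∀ n, IdentDistrib (b n) (b 0) μ μ
  mem_Icc : ∀ n, ∀ᵐ ω ∂μ, b n ω ∈ Icc 0 B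
  charges_top : ∀ ε > 0, 0 < μ {ω | dist (b 0 ω) B < ε}

variable {Ω : Type*} [MeasurableSpace Ω] {μ : Measure Ω} {b ξ : ℕ → Ω → ℝ} {B : ℝ}

theorem NoiseAssumption.control {α ℓ : ℝ} (hξ : NoiseAssumption μ ξ) (hℓ : 0 < ℓ) (hℓα : ℓ ≤ α) :
    ControlAssumption μ (fun n ω => α + ℓ * ξ n ω) (α + ℓ) where
  measurable n := ((hξ.measurable n).const_mul ℓ).const_add α
  indep := hξ.indep.comp (fun _ z => α + ℓ * z) fun _ => by fun_prop
  identDistrib n := (hξ.identDistrib n).comp (u := fun z => α + ℓ * z) (by fun_prop)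
  mem_Icc n := by
    filter_upwards [hξ.bounded n] with ω hω
    obtain ⟨hlo, hhi⟩ := abs_le.1 hω
    constructor <;> nlinarith
  charges_top ε hε := by
    refine (hξ.charges_one (ε / ℓ) (div_pos hε hℓ)).trans_le (measure_mono fun ω hω => ?_)
    have hlt : ℓ * (1 - ξ 0 ω) < ε := by
      rw [mul_comm, ← lt_div_iff₀ hℓ]
      exact sub_lt_comm.1 hω.1
    rw [mem_ofPred_eq, dist_comm, Real.dist_eq, abs_of_nonneg] <;> nlinarith [hω.2]

namespace ControlAssumption

theorem integrable_log_scrL (hb : ControlAssumption μ b B) (hB : B ∈ Ico 0 1) {L : ℝ}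
    (hL : 0 < scrL L B) : Integrable (fun ω => Real.log (scrL L (b 0 ω))) μ := by
  have := hb.indep.isProbabilityMeasure
  refine Integrable.of_mem_Icc (Real.log (scrL L B)) (Real.log L)
    (Real.measurable_log.comp ((measurable_scrL L).comp (hb.measurable 0))).aemeasurable ?_
  filter_upwards [hb.mem_Icc 0] with ω hω
  have hmem := scrL_mem_Icc hB hL.le hω
  exact ⟨Real.log_le_log hL hmem.1, Real.log_le_log (hL.trans_le hmem.1) hmem.2⟩

theorem ae_tendsto_altProd (hb : ControlAssumption μ b B) (hB : B ∈ Ico 0 1) {L₀ L₁ : ℝ}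
    (hL₀ : 0 < scrL L₀ B) (hL₁ : 0 < scrL L₁ B)
    (hlog : ∫ ω, Real.log |scrL L₀ (b 0 ω) * scrL L₁ (b 0 ω)| ∂μ < 0) :
    ∀ᵐ ω ∂μ, Tendsto (altProd L₀ L₁ fun n => b n ω) atTop (𝓝 0) := by
  have hpos : ∀ {L β}, 0 < scrL L B → β ∈ Icc 0 B → 0 < scrL L β := fun hL hβ =>
    hL.trans_le (scrL_mem_Icc hB hL.le hβ).1
  have hsum : ∫ ω, Real.log (scrL L₀ (b 0 ω)) ∂μ + ∫ ω, Real.log (scrL L₁ (b 0 ω)) ∂μ < 0 := by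
    rw [← integral_add (hb.integrable_log_scrL hB hL₀) (hb.integrable_log_scrL hB hL₁)]
    refine (integral_congr_ae ?_).trans_lt hlog
    filter_upwards [hb.mem_Icc 0] with ω hω
    rw [Real.log_abs, Real.log_mul (hpos hL₀ hω).ne' (hpos hL₁ hω).ne']
  filter_upwards [ae_tendsto_sum_ite_even_atBot hb.indep hb.identDistrib
    (Real.measurable_log.comp (measurable_scrL L₀)) (Real.measurable_log.comp (measurable_scrL L₁))
    (hb.integrable_log_scrL hB hL₀) (hb.integrable_log_scrL hB hL₁) hsum,
    ae_all_iff.2 hb.mem_Icc] with ω hω hmem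
  refine (Real.tendsto_exp_atBot.comp hω).congr fun n => ?_
  rw [Function.comp_apply, Real.exp_sum, altProd]
  refine Finset.prod_congr rfl fun j _ => ?_
  split_ifs
  exacts [Real.exp_log (hpos hL₀ (hmem j)), Real.exp_log (hpos hL₁ (hmem j))]

theorem exists_measure_contractingSet_pos (hb : ControlAssumption μ b B) (hB : B ∈ Ico 0 1)
    {L₀ L₁ : ℝ} (hL₀ : 0 < scrL L₀ B) (hL₁ : 0 < scrL L₁ B)
    (hlog : ∫ ω, Real.log |scrL L₀ (b 0 ω) * scrL L₁ (b 0 ω)| ∂μ < 0) :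
    ∃ C > 0, 0 < μ {ω | (fun n => b n ω) ∈ contractingSet L₀ L₁ C ∩ contractingSet L₁ L₀ C} := by
  have := hb.indep.isProbabilityMeasure
  have hlog' : ∫ ω, Real.log |scrL L₁ (b 0 ω) * scrL L₀ (b 0 ω)| ∂μ < 0 := by
    simpa only [mul_comm] using hlog
  have hex : ∀ᵐ ω ∂μ, ∃ m : ℕ, (fun n => b n ω) ∈
      contractingSet L₀ L₁ (m + 1) ∩ contractingSet L₁ L₀ (m + 1) := by
    filter_upwards [hb.ae_tendsto_altProd hB hL₀ hL₁ hlog, hb.ae_tendsto_altProd hB hL₁ hL₀ hlog']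
      with ω h₀ h₁
    obtain ⟨m₀, hm₀⟩ := exists_nat_mem_contractingSet h₀
    obtain ⟨m₁, hm₁⟩ := exists_nat_mem_contractingSet h₁
    exact ⟨m₀ + m₁, contractingSet_mono _ _ (by norm_cast; omega) hm₀,
      contractingSet_mono _ _ (by norm_cast; omega) hm₁⟩
  by_contra! hnull
  have hnever : ∀ᵐ ω ∂μ, ∀ m : ℕ, (fun n => b n ω) ∉
      contractingSet L₀ L₁ (m + 1) ∩ contractingSet L₁ L₀ (m + 1) :=
    ae_all_iff.2 fun m => measure_eq_zero_iff_ae_notMem.1 <|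
      nonpos_iff_eq_zero.1 (hnull (m + 1) (by positivity))
  obtain ⟨ω, ⟨m, hm⟩, hω⟩ := (hex.and hnever).exists
  exact hω m hm

end ControlAssumption

end RandomControls

end PBC

open PBC in
theorem mainTheorem1_general {Ω : Type*} [MeasurableSpace Ω] {μ : Measure Ω} {b : ℕ → Ω → ℝ}
    {f : ℝ → ℝ} {K θ Lm Lp a₁ a₂ B : ℝ} (hb : ControlAssumption μ b B)
    (hf : PositiveEquilibrium f K) (hθ : 0 < θ) (hloc : LocalLipschitz f K θ Lm Lp)
    (hside : SideSwitching f K θ a₁ a₂) (ha₁ : 0 ≤ scrL a₁ B) (ha₂ : 0 ≤ scrL a₂ B)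
    (hBs : B ∈ stabilizing f K)
    (hlog : ∫ ω, Real.log |scrL Lm (b 0 ω) * scrL Lp (b 0 ω)| ∂μ < 0) :
    ∀ᵐ ω ∂μ, ∀ y : ℕ → ℝ, IsTrajectory f (fun n => b n ω) y → 0 < y 0 →
      Tendsto y atTop (𝓝 K) := by
  have hB : B ∈ Ico 0 1 := Ioo_subset_Ico_self hBs.1
  have hK : K < fMax f K := hf.K_lt_fMax hθ (pos_of_scrL_nonneg hBs.1 ha₁) hside
  have hKmin : fMin f K < K := hf.fMin_lt_K hθ (pos_of_scrL_nonneg hBs.1 ha₂) hside hK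
  obtain ⟨C, hC, hCpos⟩ := hb.exists_measure_contractingSet_pos hB
    (ha₁.trans_lt (scrL_lt_scrL hB.2 (hside.lt_left hθ hloc)))
    (ha₂.trans_lt (scrL_lt_scrL hB.2 (hside.lt_right hθ hloc))) hlog
  obtain ⟨N, ε, hε, hnear⟩ :=
    hf.exists_dist_lt_of_dist_control_lt hBs hK hKmin (div_pos hθ hC)
  filter_upwards [ae_frequently_forall_mem_and_shift_mem hb.measurable hb.indep hb.identDistrib
    Metric.isOpen_ball.measurableSet (hb.charges_top ε hε)
    ((measurableSet_contractingSet Lm Lp C).inter (measurableSet_contractingSet Lp Lm C)) hCpos N,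
    ae_all_iff.2 hb.mem_Icc] with ω hfreq hmem y hy hy0
  obtain ⟨k₀, hk₀⟩ := hf.exists_forall_mem_Icc hB.2 hmem hy hy0 hK hKmin
  obtain ⟨k, hk, hbB, hbC⟩ := frequently_atTop.1 hfreq k₀
  obtain ⟨j, rfl⟩ := exists_add_of_le hk
  have hclose : dist (y (k₀ + j + N)) K < θ / C := hnear _ _ (hy.shift (k₀ + j))
    (fun n => hmem _) (fun n => add_assoc k₀ j n ▸ hk₀ (j + n)) hbB
  have hlim := ((hy.shift (k₀ + j)).shift N).tendsto_of_dist_lt hf.map_K hθ hloc hside hB ha₁ ha₂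
    (fun n => hmem _) hbC ((lt_div_iff₀' hC).1 hclose)
  refine (tendsto_add_atTop_iff_nat (k₀ + j + N)).1 (hlim.congr fun n => ?_)
  rw [← add_assoc, add_comm]

theorem mainTheorem1 {Ω : Type*} [MeasurableSpace Ω] (μ : Measure Ω) [IsProbabilityMeasure μ]
    (ξ : ℕ → Ω → ℝ) (hξ : PBC.NoiseAssumption μ ξ)
    (f : ℝ → ℝ) (K : ℝ) (hf : PBC.MapAssumption f K)
    (θ Lm Lp a₁ a₂ : ℝ) (hθ : 0 < θ) (hθK : θ < K)
    (hloc : PBC.LocalLipschitz f K θ Lm Lp)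
    (ha₁ : 0 < a₁) (ha₂ : 0 < a₂) (hside : PBC.SideSwitching f K θ a₁ a₂)
    (α ℓ : ℝ)
    (hlog : ∫ ω, Real.log |PBC.scrL Lm (α + ℓ * ξ 0 ω) * PBC.scrL Lp (α + ℓ * ξ 0 ω)| ∂μ < 0)
    (hsum : α + ℓ ≤ min (a₁ / (a₁ + 1)) (a₂ / (a₂ + 1)))
    (hα : α ∈ Set.Ioo 0 (PBC.betaStar f K))
    (hℓ : ℓ ∈ Set.Ioo (PBC.betaStar f K - α) (min α (1 - α)))
    (x₀ : ℝ) (hx₀ : 0 < x₀) (x : ℕ → Ω → ℝ) (hx : PBC.IsSolution f α ℓ ξ x₀ x) :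
    ∀ᵐ ω ∂μ, Filter.Tendsto (fun n => x n ω) Filter.atTop (nhds K) := by
  have hℓα : ℓ < α := hℓ.2.trans_le (min_le_left _ _)
  have hαℓ : α + ℓ < 1 := lt_sub_iff_add_lt'.1 (hℓ.2.trans_le (min_le_right _ _))
  have hβ : 0 < PBC.betaStar f K := hα.1.trans hα.2
  have hstab : α + ℓ ∈ PBC.stabilizing f K :=
    hf.positiveEquilibrium.mem_stabilizing_of_betaStar_lt hβ (sub_lt_iff_lt_add'.1 hℓ.1) hαℓ
  filter_upwards [mainTheorem1_general (hξ.control ((sub_pos.2 hα.2).trans hℓ.1) hℓα.le)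
    hf.positiveEquilibrium hθ hloc hside
    (PBC.scrL_nonneg_of_le_div (by linarith) (hsum.trans (min_le_left _ _)))
    (PBC.scrL_nonneg_of_le_div (by linarith) (hsum.trans (min_le_right _ _))) hstab hlog] with ω hω
  refine hω _ (fun n => ?_) ((hx.1 ω).symm ▸ hx₀)
  rw [hx.2 n ω, sub_sub, PBC.G]
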